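/- Let $N\ge 0$ be an integer and let $p_1,\dots,p_N\in\mathbb R^2$ be points, not necessarily distinct. For $\mu>0$ put $$u_{0,\mu}(x)=\sum_{s=1}^N\ln\frac{|x-p_s|^2}{\mu+|x-p_s|^2},\qquad H_{0,\mu}=e^{u_{0,\mu}}$$ (with $H_{0,\mu}(p_s)=0$), and for $\alpha>0$ and $v\in W^{1,2}(\mathbb R^2)$ (real-valued) put $$J(v)=\tfrac12\|\nabla v\|_2^2+\alpha^2\int_{\mathbb R^2}\Big(H_{0,\mu}\,(e^v-1-v)+(H_{0,\mu}-1)\,v\Big)\,dx,$$ where $\|\cdot\|_2$ is the norm of $L^2(\mathbb R^2)$ and $\nabla v$ is the weak gradient. Write $v_+=\max\{v,0\}$ and $v_-=\max\{-v,0\}$. Then there is a constant $b_0>0$, depending only on $p_1,\dots,p_N$, such that for every $\alpha>0$ there is $\mu_\alpha>1$ with the following property: for every $\mu>\mu_\alpha$ there is a constant $C_\mu>0$ such that for every $v\in W^{1,2}(\mathbb R^2)$ the integrand in $J(v)$ is integrable and $$J(v)\ \ge\ \tfrac14\|\nabla v\|_2^2+\frac{\alpha}{2}\|v_-\|_2+\frac{\alpha^2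 b_0}{\mu^N}\|v_+\|_2^2-C_\mu .$$ -/

import Mathlib

open MeasureTheory
open scoped ContDiff

noncomputable section

namespace PlanarVortex

/-- The plane `ℝ²` with its Euclidean norm and Lebesgue measure. -/
abbrev Plane : Type := EuclideanSpace ℝ (Fin 2)

/-- `g` is a weak (distributional) gradient of `v` on the plane:
`∫ v ∂ᵢφ = - ∫ gᵢ φ` for every test function `φ ∈ C_c^∞(ℝ²)` and `i = 1, 2`.
It is only used for `v` and `g` in `L²`, where all these integrals converge. -/
def IsWeakGradient (v : Plane → ℝ) (g : Plane → Plane) : Prop :=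
  ∀ φ : Plane → ℝ, ContDiff ℝ ∞ φ → HasCompactSupport φ → ∀ i : Fin 2,
    ∫ x, v x * fderiv ℝ φ x (EuclideanSpace.single i 1) = -∫ x, g x i * φ x

/-- The Sobolev space `W^{1,2}(ℝ²)`: `v ∈ L²` with a weak gradient in `L²`. -/
def MemW12 (v : Plane → ℝ) : Prop :=
  MemLp v 2 volume ∧ ∃ g : Plane → Plane, MemLp g 2 volume ∧ IsWeakGradient v g

open Classical in
/-- The weak gradient `∇v ∈ L²` of `v ∈ W^{1,2}(ℝ²)` (unique up to null sets; the value `0` is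
assigned if there is none). -/
def weakGrad (v : Plane → ℝ) : Plane → Plane :=
  if h : ∃ g : Plane → Plane, MemLp g 2 volume ∧ IsWeakGradient v g then h.choose else 0

theorem MemW12.weakGrad_spec {v : Plane → ℝ} (hv : MemW12 v) :
    MemLp (weakGrad v) 2 volume ∧ IsWeakGradient v (weakGrad v) := by
  unfold weakGrad
  rw [dif_pos hv.2]
  exact hv.2.choose_spec

/-- The norm `‖f‖₂` of `L²(ℝ²)`, for scalar functions and for vector fields. -/
def l2norm {F : Type*} [NormedAddCommGroup F] (f : Plane → F) : ℝ :=
  (eLpNorm f 2 volume).toReal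

/-- `u_{0,μ}(x) = ∑ₛ ln (|x - pₛ|² / (μ + |x - pₛ|²))`, for `x` different from all `pₛ`
(at the points `pₛ` the function is `-∞`, which is taken into account in `H0`). -/
def u0 {N : ℕ} (p : Fin N → Plane) (μ : ℝ) (x : Plane) : ℝ :=
  ∑ s, Real.log (‖x - p s‖ ^ 2 / (μ + ‖x - p s‖ ^ 2))

open Classical in
/-- `H_{0,μ} = exp u_{0,μ}`, with `exp (-∞) = 0` at the points `pₛ`. -/
def H0 {N : ℕ} (p : Fin N → Plane) (μ : ℝ) (x : Plane) : ℝ :=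
  if ∃ s, x = p s then 0 else Real.exp (u0 p μ x)

theorem H0_eq_prod {N : ℕ} (p : Fin N → Plane) {μ : ℝ} (hμ : 0 < μ) (x : Plane) :
    H0 p μ x = ∏ s, ‖x - p s‖ ^ 2 / (μ + ‖x - p s‖ ^ 2) := by
  unfold H0 u0
  split_ifs with h
  · obtain ⟨s, hs⟩ := h
    refine (Finset.prod_eq_zero (Finset.mem_univ s) ?_).symm
    simp [hs]
  · push Not at h
    rw [Real.exp_sum]
    refine Finset.prod_congr rfl fun s _ => Real.exp_log ?_
    have h1 : 0 < ‖x - p s‖ := norm_pos_iff.2 (sub_ne_zero.2 (h s))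
    positivity

/-- The potential term `H_{0,μ}(e^v - 1 - v) + (H_{0,μ} - 1)v` of the functional. -/
def potential {N : ℕ} (p : Fin N → Plane) (μ : ℝ) (v : Plane → ℝ) (x : Plane) : ℝ :=
  H0 p μ x * (Real.exp (v x) - 1 - v x) + (H0 p μ x - 1) * v x

/-- `J(v) = ½ ‖∇v‖₂² + α² ∫ (H_{0,μ}(e^v - 1 - v) + (H_{0,μ} - 1)v) dx`. -/
def J {N : ℕ} (p : Fin N → Plane) (α μ : ℝ) (v : Plane → ℝ) : ℝ :=
  1 / 2 * l2norm (weakGrad v) ^ 2 + α ^ 2 * ∫ x, potential p μ v x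

end PlanarVortex

end

/-!
The potential term equals `H (e^v - 1) - v` with `0 ≤ H ≤ 1`, and the two signs of `v` behave
differently.

Where `v ≤ 0`, put `w = v₋`. Since `H ≤ 1`, the potential is at least `e^{-w} - 1 + w`, hence at least
a multiple of `w² / (1 + w)`, whatever `H` does. This weak quantity controls `‖w‖₂`: by Ladyzhenskaya's
inequality `‖w²‖₂ ≤ 2c ‖w‖₂ ‖∇v‖₂`, interpolation gives
`‖w‖₂² ≤ (2 + 2c ‖∇v‖₂) ∫ w² / (1 + w)` (`MemW12.l2norm_negPart_sq_le`). The linear term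
`(α / 2) ‖w‖₂` is then absorbed by the potential and by the spare quarter of `‖∇v‖₂²`.

Where `v ≥ 0`, the potential is at least `(2μ)^{-N} v² / 4` up to an integrable function independent
of `v` (`ae_potential_ge`). Away from the vortex points `H ≥ (2μ)^{-N}`, and `1 - H ≤ -u₀` with
`u₀ ∈ L²` pays for the linear term; near them `H` vanishes, but `H e^v = e^{v + u₀}` still dominates
`v²` at the price of a multiple of `u₀²`, which is integrable because its singularities are
logarithmic. This gives `b₀ = 2^{-N} / 4`.

Integrability of the potential requires `e^v - 1 - v ∈ L¹` for all `v ∈ W^{1,2}`. With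
`F s = e^s - 1 - s`, so that `F' = F + id`, the Gagliardo–Nirenberg–Sobolev inequality
`‖f‖₂ ≤ c ‖Df‖₁` applied to `F ∘ u` gives `‖F(u)‖₂ ≤ c ‖Du‖₂ (‖F(u)‖₂ + ‖u‖₂)`, which closes when
`c ‖Du‖₂ ≤ 1 / 2`. Every `v ∈ W^{1,2}` is a test function plus a `u` with small gradient, by density of
test functions (`IsWeakGradient.exists_approx`), which is proved by mollification and cutoff.
-/

noncomputable section

namespace PlanarVortex

open scoped ENNReal NNReal Topology Convolution
open Filter

/-! ### Sobolev-type inequalities for test functions -/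

/-- The constant of the Gagliardo–Nirenberg–Sobolev inequality `‖f‖₂ ≤ c ‖Df‖₁` in the plane. -/
def gnsConst : ℝ≥0 := eLpNormLESNormFDerivOneConst (volume : Measure Plane) 2

theorem eLpNorm_two_le_fderiv_one {f : Plane → ℝ} (hf : ContDiff ℝ 1 f)
    (hc : HasCompactSupport f) :
    eLpNorm f 2 volume ≤ gnsConst * eLpNorm (fderiv ℝ f) 1 volume := by
  have h2 : NNReal.HolderConjugate (Module.finrank ℝ Plane : ℝ≥0) 2 := by
    rw [finrank_euclideanSpace_fin]
    exact_mod_cast NNReal.HolderConjugate.two_two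
  exact eLpNorm_le_eLpNorm_fderiv_one volume hf hc h2

theorem eLpNorm_comp_le_fderiv {F : ℝ → ℝ} (hF : ContDiff ℝ 1 F) (hF0 : F 0 = 0)
    {u : Plane → ℝ} (hu : ContDiff ℝ 1 u) (hc : HasCompactSupport u) :
    eLpNorm (fun x => F (u x)) 2 volume ≤
      gnsConst * (eLpNorm (fun x => deriv F (u x)) 2 volume * eLpNorm (fderiv ℝ u) 2 volume) := by
  have hFu : ContDiff ℝ 1 (fun x => F (u x)) := hF.comp hu
  have hderiv : fderiv ℝ (fun x => F (u x)) = (fun x => deriv F (u x)) • fderiv ℝ u := by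
    funext x
    have h1 : HasDerivAt F (deriv F (u x)) (u x) :=
      (hF.differentiable one_ne_zero _).hasDerivAt
    have h2 := (hu.differentiable one_ne_zero x).hasFDerivAt
    have h3 : HasFDerivAt (fun x => F (u x)) (deriv F (u x) • fderiv ℝ u x) x :=
      h1.comp_hasFDerivAt x h2
    exact h3.fderiv
  refine (eLpNorm_two_le_fderiv_one hFu (hc.comp_left hF0)).trans ?_
  gcongr
  rw [hderiv]
  have m1 : AEStronglyMeasurable (fderiv ℝ u) volume :=
    (hu.continuous_fderiv one_ne_zero).aestronglyMeasurable
  have m2 : AEStronglyMeasurable (fun x => deriv F (u x)) volume :=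
    ((hF.continuous_deriv le_rfl).comp hu.continuous).aestronglyMeasurable
  exact eLpNorm_smul_le_mul_eLpNorm (p := 2) (q := 2) (r := 1) m1 m2

/-- Smallness of the gradient makes the exponential remainder absorbable: with
`F s = eˢ - 1 - s` one has `F' = F + id`, and the inequality for `F ∘ u` closes up. -/
theorem eLpNorm_exp_sub_one_sub_le {u : Plane → ℝ} (hu : ContDiff ℝ 1 u)
    (hc : HasCompactSupport u) (hD : gnsConst * eLpNorm (fderiv ℝ u) 2 volume ≤ 1 / 2) :
    eLpNorm (fun x => Real.exp (u x) - 1 - u x) 2 volume ≤ eLpNorm u 2 volume := by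
  have hF : ContDiff ℝ 1 (fun s : ℝ => Real.exp s - 1 - s) := by fun_prop
  have hF0 : (fun s : ℝ => Real.exp s - 1 - s) 0 = 0 := by simp
  have hd : deriv (fun s : ℝ => Real.exp s - 1 - s) = fun s => Real.exp s - 1 := by
    funext s
    exact (((Real.hasDerivAt_exp s).sub_const 1).sub (hasDerivAt_id s)).deriv
  have hFu : Continuous (fun x => Real.exp (u x) - 1 - u x) := by
    have := hu.continuous
    fun_prop
  have hFc : HasCompactSupport (fun x => Real.exp (u x) - 1 - u x) :=
    hc.comp_left (g := fun s : ℝ => Real.exp s - 1 - s) hF0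
  have hfin := (hFu.memLp_of_hasCompactSupport hFc (p := 2) (μ := volume)).eLpNorm_lt_top
  have h1 := eLpNorm_comp_le_fderiv hF hF0 hu hc
  rw [hd] at h1
  have h2 : eLpNorm (fun x => Real.exp (u x) - 1) 2 volume ≤
      eLpNorm (fun x => Real.exp (u x) - 1 - u x) 2 volume + eLpNorm u 2 volume := by
    have := eLpNorm_add_le (p := 2) (μ := volume) hFu.aestronglyMeasurable
      hu.continuous.aestronglyMeasurable (by norm_num)
    convert this using 2
    funext x
    simp
  generalize eLpNorm (fun x => Real.exp (u x) - 1 - u x) 2 volume = a at *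
  generalize eLpNorm u 2 volume = b at *
  have h3 : a ≤ 1 / 2 * (a + b) := by
    calc a ≤ _ := h1
      _ = (gnsConst * eLpNorm (fderiv ℝ u) 2 volume) *
          eLpNorm (fun x => Real.exp (u x) - 1) 2 volume := by ring
      _ ≤ _ := by gcongr
  rcases eq_or_ne b ∞ with hb | hb
  · simp [hb]
  lift a to ℝ≥0 using hfin.ne
  lift b to ℝ≥0 using hb
  have h4 : (2 : ℝ≥0∞) * a ≤ a + b := by
    calc (2 : ℝ≥0∞) * a ≤ 2 * (1 / 2 * (a + b)) := by gcongr
      _ = a + b := by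
        rw [← mul_assoc, one_div, ENNReal.mul_inv_cancel (by norm_num) (by norm_num), one_mul]
  norm_cast at h4 ⊢
  have h5 : (2 : ℝ) * a ≤ a + b := by exact_mod_cast h4
  have h6 : (a : ℝ) ≤ b := by linarith
  exact_mod_cast h6

theorem hasDerivAt_negPart_sq (s : ℝ) :
    HasDerivAt (fun s : ℝ => max (-s) 0 ^ 2) (-2 * max (-s) 0) s := by
  rcases lt_trichotomy s 0 with h | h | h
  · have : (fun s : ℝ => s ^ 2) =ᶠ[𝓝 s] fun s : ℝ => max (-s) 0 ^ 2 := by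
      filter_upwards [Iio_mem_nhds h] with t ht
      rw [max_eq_left (by linarith [Set.mem_Iio.1 ht])]
      ring
    rw [max_eq_left (by linarith)]
    refine (HasDerivAt.congr_of_eventuallyEq ?_ this.symm)
    have h2 := hasDerivAt_pow 2 s
    have h3 : ((2 : ℕ) : ℝ) * s ^ (2 - 1) = -2 * -s := by norm_num
    rwa [h3] at h2
  · subst h
    rw [hasDerivAt_iff_isLittleO_nhds_zero]
    simp only [neg_zero, max_self, mul_zero, smul_zero, zero_add, sub_zero, ne_eq,
      OfNat.ofNat_ne_zero, not_false_eq_true, zero_pow]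
    have h1 : (fun h : ℝ => max (-h) 0 ^ 2) =O[𝓝 0] fun h : ℝ => h ^ 2 := by
      refine Asymptotics.IsBigO.of_bound 1 (Eventually.of_forall fun h => ?_)
      rw [one_mul, norm_pow, norm_pow]
      gcongr
      rw [Real.norm_eq_abs, Real.norm_eq_abs, abs_of_nonneg (le_max_right _ _)]
      exact max_le (neg_le_abs h) (abs_nonneg h)
    exact h1.trans_isLittleO (by
      simpa using Asymptotics.isLittleO_pow_id (𝕜 := ℝ) (n := 2) (by norm_num))
  · have : (fun _ : ℝ => (0 : ℝ)) =ᶠ[𝓝 s] fun s : ℝ => max (-s) 0 ^ 2 := by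
      filter_upwards [Ioi_mem_nhds h] with t ht
      rw [max_eq_right (by linarith [Set.mem_Ioi.1 ht])]
      ring
    rw [max_eq_right (by linarith)]
    refine (HasDerivAt.congr_of_eventuallyEq ?_ this.symm)
    simpa using hasDerivAt_const s (0 : ℝ)

/-- Ladyzhenskaya's inequality for the negative part of a test function. -/
theorem eLpNorm_negPart_sq_le {u : Plane → ℝ} (hu : ContDiff ℝ 1 u) (hc : HasCompactSupport u) :
    eLpNorm (fun x => max (-u x) 0 ^ 2) 2 volume ≤
      2 * gnsConst * (eLpNorm (fun x => max (-u x) 0) 2 volume *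
        eLpNorm (fderiv ℝ u) 2 volume) := by
  have hd : deriv (fun s : ℝ => max (-s) 0 ^ 2) = fun s => -2 * max (-s) 0 := by
    funext s
    exact (hasDerivAt_negPart_sq s).deriv
  have hF : ContDiff ℝ 1 (fun s : ℝ => max (-s) 0 ^ 2) := by
    rw [contDiff_one_iff_deriv]
    refine ⟨fun s => (hasDerivAt_negPart_sq s).differentiableAt, ?_⟩
    rw [hd]
    fun_prop
  have h1 := eLpNorm_comp_le_fderiv hF (by simp) hu hc
  rw [hd] at h1
  refine h1.trans (le_of_eq ?_)
  have : eLpNorm (fun x => -2 * max (-u x) 0) 2 volume =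
      2 * eLpNorm (fun x => max (-u x) 0) 2 volume := by
    have := eLpNorm_const_smul (-2 : ℝ) (fun x => max (-u x) 0) 2 (volume : Measure Plane)
    rw [enorm_neg, Real.enorm_eq_ofReal (by norm_num), ENNReal.ofReal_ofNat] at this
    exact this
  rw [this]
  ring

/-! ### Mollification in `L²` -/

theorem eLpNorm_two_eq_lintegral {F : Type*} [NormedAddCommGroup F] {α : Type*}
    [MeasurableSpace α] (ν : Measure α) (f : α → F) :
    eLpNorm f 2 ν = (∫⁻ x, ‖f x‖ₑ ^ 2 ∂ν) ^ (1 / 2 : ℝ) := by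
  rw [eLpNorm_eq_lintegral_rpow_enorm_toReal (by norm_num) (by norm_num)]
  simp

theorem eLpNorm_two_sq {F : Type*} [NormedAddCommGroup F] {α : Type*}
    [MeasurableSpace α] (ν : Measure α) (f : α → F) :
    eLpNorm f 2 ν ^ 2 = ∫⁻ x, ‖f x‖ₑ ^ 2 ∂ν := by
  rw [eLpNorm_two_eq_lintegral, ← ENNReal.rpow_natCast, ← ENNReal.rpow_mul]
  norm_num

theorem tendsto_eLpNorm_translate_sub {f : Plane → ℝ} (hf : MemLp f 2 volume) :
    Tendsto (fun t : Plane => eLpNorm (fun x => f (x - t) - f x) 2 volume) (𝓝 0) (𝓝 0) := by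
  have : Fact ((2 : ℝ≥0∞) ≠ ⊤) := ⟨by norm_num⟩
  have hcont : Continuous fun t : Plane => DomAddAct.mk (-t) +ᵥ hf.toLp f := by
    have : Continuous fun t : Plane => (DomAddAct.mk (-t) : Planeᵈᵃᵃ) :=
      DomAddAct.continuous_mk.comp continuous_neg
    exact this.vadd continuous_const
  have h0 : DomAddAct.mk (-(0 : Plane)) +ᵥ hf.toLp f = hf.toLp f := by simp
  have h1 := (hcont.tendsto 0).edist (tendsto_const_nhds (x := hf.toLp f))
  rw [h0, edist_self] at h1
  refine h1.congr fun t => ?_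
  rw [DomAddAct.mk_vadd_toLp, Lp.edist_toLp_toLp]
  congr 1
  funext x
  simp [sub_eq_neg_add]

/-- Jensen's inequality and Tonelli's theorem: a weighted average of translates of `f` is at least
as close to `f` in `L²` as the worst of them. -/
theorem eLpNorm_convolution_sub_le {f ρ : Plane → ℝ} (hf : MemLp f 2 volume)
    (hρ : Continuous ρ) (hρc : HasCompactSupport ρ) (hρ0 : ∀ x, 0 ≤ ρ x) (hρ1 : ∫ x, ρ x = 1)
    {δ : ℝ≥0∞} (hδ : ∀ t, ρ t ≠ 0 → eLpNorm (fun x => f (x - t) - f x) 2 volume ≤ δ) :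
    eLpNorm (fun x => (f ⋆[ContinuousLinearMap.mul ℝ ℝ, volume] ρ) x - f x) 2 volume ≤ δ := by
  have hρi : Integrable ρ := hρ.integrable_of_hasCompactSupport hρc
  have hloc : LocallyIntegrable f volume := hf.locallyIntegrable (by norm_num)
  set ν : Measure Plane := volume.withDensity fun t => ENNReal.ofReal (ρ t) with hν
  have hmeasρ : Measurable fun t => ENNReal.ofReal (ρ t) := hρ.measurable.ennreal_ofReal
  have hprob : IsProbabilityMeasure ν := by
    refine ⟨?_⟩
    rw [hν, withDensity_apply _ MeasurableSet.univ, Measure.restrict_univ,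
      ← ofReal_integral_eq_lintegral_ofReal hρi (Eventually.of_forall hρ0), hρ1,
      ENNReal.ofReal_one]
  have hac : ν ≪ volume := withDensity_absolutelyContinuous _ _
  have hpt : ∀ x, ‖(f ⋆[ContinuousLinearMap.mul ℝ ℝ, volume] ρ) x - f x‖ₑ ^ 2 ≤
      ∫⁻ t, ‖f (x - t) - f x‖ₑ ^ 2 ∂ν := by
    intro x
    have hconv : ConvolutionExistsAt f ρ x (ContinuousLinearMap.mul ℝ ℝ) volume :=
      hρc.convolutionExists_right _ hloc hρ x
    have hint : Integrable (fun t => f (x - t) * ρ t) := hconv.integrable_swap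
    have h1 : (f ⋆[ContinuousLinearMap.mul ℝ ℝ, volume] ρ) x - f x =
        ∫ t, (f (x - t) - f x) * ρ t := by
      rw [convolution_eq_swap]
      simp only [ContinuousLinearMap.mul_apply', sub_mul]
      rw [integral_sub hint (hρi.const_mul _), integral_const_mul, hρ1, mul_one]
    have hm : AEStronglyMeasurable (fun t => f (x - t) - f x) ν := by
      refine AEStronglyMeasurable.mono_ac hac (AEStronglyMeasurable.sub ?_
        aestronglyMeasurable_const)
      exact hf.1.comp_quasiMeasurePreserving
        (quasiMeasurePreserving_sub_left_of_right_invariant volume x)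
    have h2 : ‖(f ⋆[ContinuousLinearMap.mul ℝ ℝ, volume] ρ) x - f x‖ₑ ≤
        eLpNorm (fun t => f (x - t) - f x) 1 ν := by
      rw [h1, eLpNorm_one_eq_lintegral_enorm, hν,
        lintegral_withDensity_eq_lintegral_mul_non_measurable _ hmeasρ
          (Eventually.of_forall fun t => ENNReal.ofReal_lt_top)]
      refine (enorm_integral_le_lintegral_enorm _).trans (le_of_eq ?_)
      refine lintegral_congr fun t => ?_
      rw [enorm_mul, Real.enorm_eq_ofReal (hρ0 t), mul_comm]
      rfl
    calc _ ≤ eLpNorm (fun t => f (x - t) - f x) 2 ν ^ 2 := by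
          gcongr
          exact h2.trans (eLpNorm_le_eLpNorm_of_exponent_le (by norm_num) hm)
      _ = _ := eLpNorm_two_sq _ _
  have hjoint : AEMeasurable (fun z : Plane × Plane => ‖f (z.1 - z.2) - f z.1‖ₑ ^ 2)
      (volume.prod ν) := by
    have h1 : AEStronglyMeasurable (fun z : Plane × Plane => f (z.1 - z.2)) (volume.prod ν) :=
      hf.1.comp_quasiMeasurePreserving
        (quasiMeasurePreserving_sub_of_right_invariant volume ν)
    exact ((h1.sub hf.1.comp_fst).enorm).pow_const 2
  have hmain : eLpNorm (fun x => (f ⋆[ContinuousLinearMap.mul ℝ ℝ, volume] ρ) x - f x) 2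
      volume ^ 2 ≤ δ ^ 2 := by
    rw [eLpNorm_two_sq]
    calc _ ≤ ∫⁻ x, ∫⁻ t, ‖f (x - t) - f x‖ₑ ^ 2 ∂ν := lintegral_mono hpt
      _ = ∫⁻ t, (∫⁻ x, ‖f (x - t) - f x‖ₑ ^ 2) ∂ν := lintegral_lintegral_swap hjoint
      _ ≤ ∫⁻ _, δ ^ 2 ∂ν := by
        refine lintegral_mono_ae ?_
        rw [hν, ae_withDensity_iff hmeasρ]
        refine Eventually.of_forall fun t ht => ?_
        rw [← eLpNorm_two_sq]
        gcongr
        exact hδ t fun h => ht (by simp [h])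
      _ = δ ^ 2 := by simp
  exact (ENNReal.pow_le_pow_left_iff two_ne_zero).1 hmain

/-- Bump functions at the origin whose supports shrink to a point. -/
def shrinkingBump (n : ℕ) : ContDiffBump (0 : Plane) where
  rIn := 1 / 2 / ((n : ℝ) + 1)
  rOut := 1 / ((n : ℝ) + 1)
  rIn_pos := by positivity
  rIn_lt_rOut := by gcongr; norm_num

/-- The standard mollifiers: smooth probability densities concentrating at the origin. -/
def mollifier (n : ℕ) : Plane → ℝ := (shrinkingBump n).normed volume

theorem contDiff_mollifier (n : ℕ) {k : ℕ∞} : ContDiff ℝ k (mollifier n) :=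
  (shrinkingBump n).contDiff_normed

theorem hasCompactSupport_mollifier (n : ℕ) : HasCompactSupport (mollifier n) :=
  (shrinkingBump n).hasCompactSupport_normed

theorem tendsto_eLpNorm_mollify_sub {f : Plane → ℝ} (hf : MemLp f 2 volume) :
    Tendsto (fun n => eLpNorm
      (fun x => (f ⋆[ContinuousLinearMap.mul ℝ ℝ, volume] mollifier n) x - f x) 2 volume)
      atTop (𝓝 0) := by
  rw [ENNReal.tendsto_nhds_zero]
  intro δ hδ
  obtain ⟨r, hr, hball⟩ := Metric.eventually_nhds_iff_ball.1
    (ENNReal.tendsto_nhds_zero.1 (tendsto_eLpNorm_translate_sub hf) δ hδ)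
  obtain ⟨n₀, hn₀⟩ := exists_nat_one_div_lt hr
  filter_upwards [eventually_ge_atTop n₀] with n hn
  refine eLpNorm_convolution_sub_le hf (contDiff_mollifier n (k := 0)).continuous
    (hasCompactSupport_mollifier n) (shrinkingBump n).nonneg_normed
    (shrinkingBump n).integral_normed fun t ht => hball t ?_
  have hts : t ∈ Function.support ((shrinkingBump n).normed volume) := ht
  rw [ContDiffBump.support_normed_eq] at hts
  refine Metric.ball_subset_ball ?_ hts
  refine le_trans ?_ hn₀.le
  have : (n₀ : ℝ) ≤ n := by exact_mod_cast hn
  show 1 / ((n : ℝ) + 1) ≤ _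
  gcongr

/-- Mollification turns a weak gradient into a classical one: test the weak gradient against
`t ↦ ρ (x - t)`. -/
theorem IsWeakGradient.fderiv_convolution {v : Plane → ℝ} {g : Plane → Plane}
    (h : IsWeakGradient v g) (hv : LocallyIntegrable v volume) {ρ : Plane → ℝ}
    (hρ : ContDiff ℝ ∞ ρ) (hρc : HasCompactSupport ρ) (x : Plane) (i : Fin 2) :
    fderiv ℝ (v ⋆[ContinuousLinearMap.mul ℝ ℝ, volume] ρ) x (EuclideanSpace.single i 1) =
      ((fun y => g y i) ⋆[ContinuousLinearMap.mul ℝ ℝ, volume] ρ) x := by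
  have hρ1 : ContDiff ℝ 1 ρ := hρ.of_le (by exact_mod_cast le_top)
  rw [(hρc.hasFDerivAt_convolution_right (ContinuousLinearMap.mul ℝ ℝ) hv hρ1 x).fderiv,
    convolution_precompR_apply _ hv (hρc.fderiv ℝ) (hρ1.continuous_fderiv one_ne_zero),
    convolution_def, convolution_def]
  simp only [ContinuousLinearMap.mul_apply']
  have hφ : ContDiff ℝ ∞ fun t => ρ (x - t) := hρ.comp (contDiff_const.sub contDiff_id)
  have hφc : HasCompactSupport fun t => ρ (x - t) :=
    hρc.comp_homeomorph (Homeomorph.subLeft x)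
  have hder : ∀ t, fderiv ℝ (fun t => ρ (x - t)) t = -fderiv ℝ ρ (x - t) := by
    intro t
    have h1 : HasFDerivAt (fun t : Plane => x - t) (-ContinuousLinearMap.id ℝ Plane) t :=
      (hasFDerivAt_id t).const_sub x
    have h2 := (hρ1.differentiable one_ne_zero (x - t)).hasFDerivAt
    have h3 : HasFDerivAt (fun t => ρ (x - t))
      ((fderiv ℝ ρ (x - t)).comp (-ContinuousLinearMap.id ℝ Plane)) t := h2.comp t h1
    rw [h3.fderiv]
    ext y
    simp
  have h1 := h _ hφ hφc i
  simp only [hder, neg_apply, mul_neg, integral_neg] at h1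
  exact neg_injective h1

/-! ### Cutoffs and density of test functions in `W^{1,2}` -/

/-- A smooth cutoff, equal to `1` on the ball of radius `1`. -/
def unitBump : ContDiffBump (0 : Plane) := ⟨1, 2, one_pos, one_lt_two⟩

/-- Smooth cutoffs equal to `1` on the ball of radius `n + 1`, with gradient `O(1 / (n + 1))`. -/
def cutoff (n : ℕ) (x : Plane) : ℝ := unitBump ((1 / ((n : ℝ) + 1)) • x)

theorem contDiff_cutoff (n : ℕ) {k : ℕ∞} : ContDiff ℝ k (cutoff n) :=
  unitBump.contDiff.comp (contDiff_const_smul _)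

theorem hasCompactSupport_cutoff (n : ℕ) : HasCompactSupport (cutoff n) :=
  unitBump.hasCompactSupport.comp_homeomorph
    (Homeomorph.smulOfNeZero (1 / ((n : ℝ) + 1)) (by positivity))

theorem norm_cutoff_le (n : ℕ) (x : Plane) : ‖cutoff n x‖ ≤ 1 := by
  have h0 : 0 ≤ cutoff n x := unitBump.nonneg
  rw [Real.norm_eq_abs, abs_of_nonneg h0]
  exact unitBump.le_one

theorem norm_cutoff_sub_one_le (n : ℕ) (x : Plane) : ‖cutoff n x - 1‖ ≤ 1 := by
  have h0 : 0 ≤ cutoff n x := unitBump.nonneg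
  have h1 : cutoff n x ≤ 1 := unitBump.le_one
  rw [Real.norm_eq_abs, abs_le]
  constructor <;> linarith

theorem eventually_cutoff_eq_one (x : Plane) : ∀ᶠ n in atTop, cutoff n x = 1 := by
  obtain ⟨n₀, hn₀⟩ := exists_nat_ge ‖x‖
  filter_upwards [eventually_ge_atTop n₀] with n hn
  refine unitBump.one_of_mem_closedBall ?_
  rw [mem_closedBall_zero_iff, norm_smul, Real.norm_of_nonneg (by positivity), one_div,
    inv_mul_le_iff₀ (by positivity)]
  have : (n₀ : ℝ) ≤ n := by exact_mod_cast hn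
  show ‖x‖ ≤ ((n : ℝ) + 1) * 1
  linarith

theorem exists_norm_fderiv_cutoff_le :
    ∃ M : ℝ, 0 ≤ M ∧ ∀ n x, ‖fderiv ℝ (cutoff n) x‖ ≤ 1 / ((n : ℝ) + 1) * M := by
  have hχ : ContDiff ℝ 1 (unitBump : Plane → ℝ) := unitBump.contDiff
  obtain ⟨M, hM⟩ := (unitBump.hasCompactSupport.fderiv ℝ).exists_bound_of_continuous
    (hχ.continuous_fderiv one_ne_zero)
  refine ⟨M, (norm_nonneg _).trans (hM 0), fun n x => ?_⟩
  set c : ℝ := 1 / ((n : ℝ) + 1) with hc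
  have hc0 : 0 ≤ c := by positivity
  have h1 : HasFDerivAt (fun x : Plane => c • x) (c • ContinuousLinearMap.id ℝ Plane) x :=
    (hasFDerivAt_id x).const_smul c
  have h2 := (hχ.differentiable one_ne_zero (c • x)).hasFDerivAt
  have h3 : HasFDerivAt (cutoff n)
    ((fderiv ℝ unitBump (c • x)).comp (c • ContinuousLinearMap.id ℝ Plane)) x := h2.comp x h1
  rw [h3.fderiv, ContinuousLinearMap.comp_smul, ContinuousLinearMap.comp_id, norm_smul,
    Real.norm_of_nonneg hc0]
  gcongr
  exact hM _

theorem tendsto_eLpNorm_cutoff_sub_one_smul {F : Type*} [NormedAddCommGroup F] [NormedSpace ℝ F]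
    {f : Plane → F} (hf : MemLp f 2 volume) :
    Tendsto (fun n => eLpNorm (fun x => (cutoff n x - 1) • f x) 2 volume) atTop (𝓝 0) := by
  have hfin : ∫⁻ x, ‖f x‖ₑ ^ 2 ≠ ⊤ := by
    rw [← eLpNorm_two_sq]
    exact ENNReal.pow_ne_top hf.eLpNorm_ne_top
  have h1 : Tendsto (fun n => ∫⁻ x, ‖(cutoff n x - 1) • f x‖ₑ ^ 2) atTop
      (𝓝 (∫⁻ _ : Plane, 0)) := by
    refine tendsto_lintegral_of_dominated_convergence' (fun x => ‖f x‖ₑ ^ 2) (fun n => ?_)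
      (fun n => Eventually.of_forall fun x => ?_) hfin (Eventually.of_forall fun x => ?_)
    · have : AEStronglyMeasurable (fun x => cutoff n x - 1) volume :=
        ((contDiff_cutoff n (k := 0)).continuous.sub continuous_const).aestronglyMeasurable
      exact ((this.smul hf.1).enorm).pow_const 2
    · simp only [enorm_smul]
      gcongr
      refine mul_le_of_le_one_left' ?_
      rw [← ofReal_norm]
      exact ENNReal.ofReal_le_one.2 (norm_cutoff_sub_one_le n x)
    · refine tendsto_const_nhds.congr' ?_
      filter_upwards [eventually_cutoff_eq_one x] with n hn
      simp [hn]
  simp only [eLpNorm_two_eq_lintegral]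
  have h2 := (ENNReal.continuous_rpow_const (y := 1 / 2)).tendsto (∫⁻ _ : Plane, 0)
  have h3 := h2.comp h1
  simpa [Function.comp_def] using h3

theorem norm_clm_le_sum (ℓ : Plane →L[ℝ] ℝ) :
    ‖ℓ‖ ≤ ‖ℓ (EuclideanSpace.single 0 1)‖ + ‖ℓ (EuclideanSpace.single 1 1)‖ := by
  refine ℓ.opNorm_le_bound (by positivity) fun x => ?_
  have hx : x = x 0 • EuclideanSpace.single (0 : Fin 2) (1 : ℝ) +
      x 1 • EuclideanSpace.single (1 : Fin 2) (1 : ℝ) := by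
    ext i
    fin_cases i <;> simp
  have h : ∀ i, ‖x i‖ ≤ ‖x‖ := fun i => PiLp.norm_apply_le x i
  calc ‖ℓ x‖ = ‖x 0 • ℓ (EuclideanSpace.single 0 1) + x 1 • ℓ (EuclideanSpace.single 1 1)‖ := by
        conv_lhs => rw [hx]
        simp
    _ ≤ ‖x 0‖ * ‖ℓ (EuclideanSpace.single 0 1)‖ + ‖x 1‖ * ‖ℓ (EuclideanSpace.single 1 1)‖ := by
        refine (norm_add_le _ _).trans ?_
        rw [norm_smul, norm_smul]
    _ ≤ ‖x‖ * ‖ℓ (EuclideanSpace.single 0 1)‖ + ‖x‖ * ‖ℓ (EuclideanSpace.single 1 1)‖ := by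
        gcongr <;> exact h _
    _ = _ := by ring

theorem memLp_apply {g : Plane → Plane} (hg : MemLp g 2 volume) (i : Fin 2) :
    MemLp (fun x => g x i) 2 volume :=
  (EuclideanSpace.proj (𝕜 := ℝ) i : Plane →L[ℝ] ℝ).comp_memLp' hg

theorem memLp_innerSL {g : Plane → Plane} (hg : MemLp g 2 volume) :
    MemLp (fun x => innerSL ℝ (g x)) 2 volume :=
  hg.of_le ((innerSL ℝ).continuous.comp_aestronglyMeasurable hg.1)
    (Eventually.of_forall fun x => by rw [innerSL_apply_norm])

theorem IsWeakGradient.tendsto_fderiv_mollify_sub {v : Plane → ℝ} {g : Plane → Plane}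
    (h : IsWeakGradient v g) (hv : MemLp v 2 volume) (hg : MemLp g 2 volume) :
    Tendsto (fun n => eLpNorm
      (fun x => fderiv ℝ (v ⋆[ContinuousLinearMap.mul ℝ ℝ, volume] mollifier n) x -
        innerSL ℝ (g x)) 2 volume) atTop (𝓝 0) := by
  have hloc : LocallyIntegrable v volume := hv.locallyIntegrable (by norm_num)
  have hsum := (tendsto_eLpNorm_mollify_sub (memLp_apply hg 0)).add
    (tendsto_eLpNorm_mollify_sub (memLp_apply hg 1))
  rw [add_zero] at hsum
  refine tendsto_of_tendsto_of_tendsto_of_le_of_le tendsto_const_nhds hsum (fun n => zero_le)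
    fun n => ?_
  have hm : ∀ i : Fin 2, AEStronglyMeasurable (fun x => ((fun y => g y i)
      ⋆[ContinuousLinearMap.mul ℝ ℝ, volume] mollifier n) x - g x i) volume := by
    intro i
    have hi := memLp_apply hg i
    exact ((hasCompactSupport_mollifier n).continuous_convolution_right _
      (hi.locallyIntegrable (by norm_num))
      (contDiff_mollifier n (k := 0)).continuous).aestronglyMeasurable.sub hi.1
  refine le_trans ?_ ((eLpNorm_add_le (p := 2) (hm 0).norm (hm 1).norm (by norm_num)).trans
    (le_of_eq (by rw [eLpNorm_norm, eLpNorm_norm])))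
  refine eLpNorm_mono_real fun x => ?_
  refine (norm_clm_le_sum _).trans (le_of_eq ?_)
  simp only [sub_apply, innerSL_apply_apply, Pi.add_apply,
    h.fderiv_convolution hloc (contDiff_mollifier n) (hasCompactSupport_mollifier n)]
  simp [EuclideanSpace.inner_single_right]

/-- Compactly supported `C¹` functions (in fact smooth ones) are dense in `W^{1,2}`: mollify, then
cut off. The classical derivative is compared with the weak gradient seen as a linear form. -/
theorem IsWeakGradient.exists_approx {v : Plane → ℝ} {g : Plane → Plane}
    (h : IsWeakGradient v g) (hv : MemLp v 2 volume) (hg : MemLp g 2 volume) :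
    ∃ φ : ℕ → Plane → ℝ, (∀ n, ContDiff ℝ 1 (φ n)) ∧ (∀ n, HasCompactSupport (φ n)) ∧
      Tendsto (fun n => eLpNorm (fun x => φ n x - v x) 2 volume) atTop (𝓝 0) ∧
      Tendsto (fun n => eLpNorm (fun x => fderiv ℝ (φ n) x - innerSL ℝ (g x)) 2 volume)
        atTop (𝓝 0) := by
  have hloc : LocallyIntegrable v volume := hv.locallyIntegrable (by norm_num)
  set w : ℕ → Plane → ℝ := fun n => v ⋆[ContinuousLinearMap.mul ℝ ℝ, volume] mollifier n
  have hwC : ∀ n, ContDiff ℝ 1 (w n) := fun n =>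
    (hasCompactSupport_mollifier n).contDiff_convolution_right _ hloc (contDiff_mollifier n)
  have hχC : ∀ n, ContDiff ℝ 1 (cutoff n) := fun n => contDiff_cutoff n
  have hwv := tendsto_eLpNorm_mollify_sub hv
  have hwg := h.tendsto_fderiv_mollify_sub hv hg
  have hG := memLp_innerSL hg
  have hmw : ∀ n, AEStronglyMeasurable (w n) volume :=
    fun n => (hwC n).continuous.aestronglyMeasurable
  have hmχ : ∀ n, AEStronglyMeasurable (cutoff n) volume :=
    fun n => (hχC n).continuous.aestronglyMeasurable
  have hmdw : ∀ n, AEStronglyMeasurable (fderiv ℝ (w n)) volume :=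
    fun n => ((hwC n).continuous_fderiv one_ne_zero).aestronglyMeasurable
  have hmdχ : ∀ n, AEStronglyMeasurable (fderiv ℝ (cutoff n)) volume :=
    fun n => ((hχC n).continuous_fderiv one_ne_zero).aestronglyMeasurable
  refine ⟨fun n x => cutoff n x * w n x, fun n => (hχC n).mul (hwC n),
    fun n => (hasCompactSupport_cutoff n).mul_right, ?_, ?_⟩
  · have hsum := hwv.add (tendsto_eLpNorm_cutoff_sub_one_smul hv)
    rw [add_zero] at hsum
    refine tendsto_of_tendsto_of_tendsto_of_le_of_le tendsto_const_nhds hsum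
      (fun n => zero_le) fun n => ?_
    have hd : (fun x => cutoff n x * w n x - v x) =
        (fun x => cutoff n x • (w n x - v x)) + fun x => (cutoff n x - 1) • v x := by
      funext x
      simp only [Pi.add_apply, smul_eq_mul]
      ring
    simp only [hd]
    refine (eLpNorm_add_le ((hmχ n).smul ((hmw n).sub hv.1))
      (((hmχ n).sub aestronglyMeasurable_const).smul hv.1) (by norm_num)).trans ?_
    refine add_le_add ?_ le_rfl
    refine eLpNorm_mono fun x => ?_
    rw [Pi.smul_apply', norm_smul]
    exact mul_le_of_le_one_left (norm_nonneg _) (norm_cutoff_le n x)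
  · obtain ⟨M, hM0, hM⟩ := exists_norm_fderiv_cutoff_le
    have hlast : Tendsto (fun n : ℕ => ENNReal.ofReal (1 / ((n : ℝ) + 1) * M) *
        (eLpNorm (fun x => w n x - v x) 2 volume + eLpNorm v 2 volume)) atTop (𝓝 0) := by
      have h1 : Tendsto (fun n : ℕ => ENNReal.ofReal (1 / ((n : ℝ) + 1) * M)) atTop (𝓝 0) := by
        have := (tendsto_one_div_add_atTop_nhds_zero_nat (𝕜 := ℝ)).mul_const M
        rw [zero_mul] at this
        simpa using ENNReal.tendsto_ofReal this
      have h2 := hwv.add_const (eLpNorm v 2 volume)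
      have h3 := ENNReal.Tendsto.mul h1 (Or.inr (by simpa using hv.eLpNorm_ne_top)) h2
        (Or.inr ENNReal.zero_ne_top)
      simpa using h3
    have hsum := (hwg.add (tendsto_eLpNorm_cutoff_sub_one_smul hG)).add hlast
    simp only [add_zero] at hsum
    refine tendsto_of_tendsto_of_tendsto_of_le_of_le tendsto_const_nhds hsum
      (fun n => zero_le) fun n => ?_
    have hd : (fun x => fderiv ℝ (fun x => cutoff n x * w n x) x - innerSL ℝ (g x)) =
        ((fun x => cutoff n x • (fderiv ℝ (w n) x - innerSL ℝ (g x))) +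
          fun x => (cutoff n x - 1) • innerSL ℝ (g x)) +
          fun x => w n x • fderiv ℝ (cutoff n) x := by
      funext x
      have := fderiv_fun_mul ((hχC n).differentiable one_ne_zero x)
        ((hwC n).differentiable one_ne_zero x)
      rw [this]
      simp only [Pi.add_apply, smul_sub, sub_smul, one_smul]
      abel
    have m1 := (hmχ n).smul ((hmdw n).sub hG.1)
    have m2 := ((hmχ n).sub (aestronglyMeasurable_const (b := (1 : ℝ)))).smul hG.1
    have m3 := (hmw n).smul (hmdχ n)
    simp only [hd]
    refine (eLpNorm_add_le (m1.add m2) m3 (by norm_num)).trans ?_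
    refine add_le_add ((eLpNorm_add_le m1 m2 (by norm_num)).trans ?_) ?_
    · refine add_le_add ?_ le_rfl
      refine eLpNorm_mono fun x => ?_
      rw [Pi.smul_apply', norm_smul]
      exact mul_le_of_le_one_left (norm_nonneg _) (norm_cutoff_le n x)
    · have hc0 : 0 ≤ 1 / ((n : ℝ) + 1) * M := by positivity
      calc eLpNorm (fun x => w n x • fderiv ℝ (cutoff n) x) 2 volume
          ≤ eLpNorm ((1 / ((n : ℝ) + 1) * M) • w n) 2 volume := by
            refine eLpNorm_mono fun x => ?_
            rw [Pi.smul_apply, norm_smul, norm_smul, Real.norm_of_nonneg hc0, mul_comm]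
            gcongr
            exact hM n x
        _ = ENNReal.ofReal (1 / ((n : ℝ) + 1) * M) * eLpNorm (w n) 2 volume := by
            rw [eLpNorm_const_smul, Real.enorm_eq_ofReal hc0]
        _ ≤ _ := by
            gcongr
            have := eLpNorm_add_le (p := 2) (μ := volume) ((hmw n).sub hv.1) hv.1 (by norm_num)
            rwa [sub_add_cancel] at this

/-! ### Inequalities in `W^{1,2}` -/

theorem eLpNorm_innerSL (g : Plane → Plane) :
    eLpNorm (fun x => innerSL ℝ (g x)) 2 volume = eLpNorm g 2 volume :=
  eLpNorm_congr_norm_ae (Eventually.of_forall fun x => by rw [innerSL_apply_norm])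

theorem IsWeakGradient.exists_approx_ae {v : Plane → ℝ} {g : Plane → Plane}
    (h : IsWeakGradient v g) (hv : MemLp v 2 volume) (hg : MemLp g 2 volume) :
    ∃ φ : ℕ → Plane → ℝ, (∀ n, ContDiff ℝ 1 (φ n)) ∧ (∀ n, HasCompactSupport (φ n)) ∧
      Tendsto (fun n => eLpNorm (fun x => φ n x - v x) 2 volume) atTop (𝓝 0) ∧
      Tendsto (fun n => eLpNorm (fun x => fderiv ℝ (φ n) x - innerSL ℝ (g x)) 2 volume)
        atTop (𝓝 0) ∧
      ∀ᵐ x, Tendsto (fun n => φ n x) atTop (𝓝 (v x)) := by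
  obtain ⟨φ, h1, h2, h3, h4⟩ := h.exists_approx hv hg
  have hm : TendstoInMeasure volume φ atTop v :=
    tendstoInMeasure_of_tendsto_eLpNorm (p := 2) (by norm_num)
      (fun n => (h1 n).continuous.aestronglyMeasurable) hv.1 h3
  obtain ⟨ns, hns, hae⟩ := hm.exists_seq_tendsto_ae
  exact ⟨fun n => φ (ns n), fun n => h1 _, fun n => h2 _, h3.comp hns.tendsto_atTop,
    h4.comp hns.tendsto_atTop, hae⟩

/-- Ladyzhenskaya's inequality for the negative part of a function in `W^{1,2}`. -/
theorem IsWeakGradient.eLpNorm_negPart_sq_le {v : Plane → ℝ} {g : Plane → Plane}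
    (h : IsWeakGradient v g) (hv : MemLp v 2 volume) (hg : MemLp g 2 volume) :
    eLpNorm (fun x => max (-v x) 0 ^ 2) 2 volume ≤
      2 * gnsConst * (eLpNorm (fun x => max (-v x) 0) 2 volume * eLpNorm g 2 volume) := by
  obtain ⟨φ, hC, hc, hφ, hD, hae⟩ := h.exists_approx_ae hv hg
  have hmφ : ∀ n, AEStronglyMeasurable (φ n) volume :=
    fun n => (hC n).continuous.aestronglyMeasurable
  have hmD : ∀ n, AEStronglyMeasurable (fderiv ℝ (φ n)) volume :=
    fun n => ((hC n).continuous_fderiv one_ne_zero).aestronglyMeasurable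
  have hG := memLp_innerSL hg
  have hcont : Continuous fun s : ℝ => max (-s) 0 := by fun_prop
  have hvneg : MemLp (fun x => max (-v x) 0) 2 volume := by
    refine hv.of_le (hcont.comp_aestronglyMeasurable hv.1) (Eventually.of_forall fun x => ?_)
    rw [Real.norm_eq_abs, Real.norm_eq_abs, abs_of_nonneg (le_max_right _ _)]
    exact max_le (neg_le_abs _) (abs_nonneg _)
  have hFatou := Lp.eLpNorm_lim_le_liminf_eLpNorm (p := 2) (μ := (volume : Measure Plane))
    (f := fun n x => max (-φ n x) 0 ^ 2)
    (fun n => (hcont.pow 2).comp_aestronglyMeasurable (hmφ n)) (fun x => max (-v x) 0 ^ 2)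
    (hae.mono fun x hx => ((hcont.pow 2).tendsto _).comp hx)
  refine hFatou.trans ?_
  have hb1 : ∀ n, eLpNorm (fun x => max (-φ n x) 0) 2 volume ≤
      eLpNorm (fun x => φ n x - v x) 2 volume + eLpNorm (fun x => max (-v x) 0) 2 volume := by
    intro n
    have hadd := eLpNorm_add_le (p := 2) ((hmφ n).sub hv.1).norm hvneg.1 (by norm_num)
    rw [eLpNorm_norm] at hadd
    refine le_trans (eLpNorm_mono_real fun x => ?_) hadd
    rw [Real.norm_eq_abs, abs_of_nonneg (le_max_right _ _)]
    simp only [Pi.add_apply, Pi.sub_apply, Real.norm_eq_abs]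
    refine max_le ?_ (add_nonneg (abs_nonneg _) (le_max_right _ _))
    have h1 := neg_abs_le (φ n x - v x)
    have h2 := le_max_left (-v x) 0
    linarith
  have hb2 : ∀ n, eLpNorm (fderiv ℝ (φ n)) 2 volume ≤
      eLpNorm (fun x => fderiv ℝ (φ n) x - innerSL ℝ (g x)) 2 volume + eLpNorm g 2 volume := by
    intro n
    have hadd := eLpNorm_add_le (p := 2) ((hmD n).sub hG.1) hG.1 (by norm_num)
    rwa [sub_add_cancel, eLpNorm_innerSL] at hadd
  have hlim : Tendsto (fun n => 2 * (gnsConst : ℝ≥0∞) *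
      ((eLpNorm (fun x => φ n x - v x) 2 volume + eLpNorm (fun x => max (-v x) 0) 2 volume) *
      (eLpNorm (fun x => fderiv ℝ (φ n) x - innerSL ℝ (g x)) 2 volume + eLpNorm g 2 volume)))
      atTop (𝓝 (2 * gnsConst * ((0 + eLpNorm (fun x => max (-v x) 0) 2 volume) *
        (0 + eLpNorm g 2 volume)))) := by
    refine ENNReal.Tendsto.const_mul (ENNReal.Tendsto.mul (hφ.add_const _) (Or.inr ?_)
      (hD.add_const _) (Or.inr ?_)) (Or.inr ?_)
    · simpa using hg.eLpNorm_ne_top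
    · simpa using hvneg.eLpNorm_ne_top
    · exact ENNReal.mul_ne_top (by norm_num) ENNReal.coe_ne_top
  rw [zero_add, zero_add] at hlim
  rw [← hlim.liminf_eq]
  refine liminf_le_liminf (Eventually.of_forall fun n => ?_)
  refine (PlanarVortex.eLpNorm_negPart_sq_le (hC n) (hc n)).trans ?_
  gcongr
  · exact hb1 n
  · exact hb2 n

theorem exp_sub_one_sub_nonneg (s : ℝ) : 0 ≤ Real.exp s - 1 - s := by
  linarith [Real.add_one_le_exp s]

theorem exp_sub_one_sub_le_mul (s : ℝ) : Real.exp s - 1 - s ≤ s * (Real.exp s - 1) := by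
  have h1 := Real.add_one_le_exp (-s)
  have h2 := Real.exp_pos s
  have h3 : Real.exp s * Real.exp (-s) = 1 := by rw [← Real.exp_add]; simp
  nlinarith

/-- The Moser–Trudinger type fact behind the functional: `e^v - 1 - v` is integrable for every
`v ∈ W^{1,2}`. Write `v = φ + u` with a test function `φ` and `u` of small gradient; then `e^φ` is
bounded and `e^u - 1 ∈ L²` by the smooth inequality and Fatou's lemma. -/
theorem IsWeakGradient.integrable_exp_sub_one_sub {v : Plane → ℝ} {g : Plane → Plane}
    (h : IsWeakGradient v g) (hv : MemLp v 2 volume) (hg : MemLp g 2 volume) :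
    Integrable (fun x => Real.exp (v x) - 1 - v x) volume := by
  obtain ⟨φ, hC, hc, hφ, hD, hae⟩ := h.exists_approx_ae hv hg
  have hmφ : ∀ n, AEStronglyMeasurable (φ n) volume :=
    fun n => (hC n).continuous.aestronglyMeasurable
  have hmD : ∀ n, AEStronglyMeasurable (fderiv ℝ (φ n)) volume :=
    fun n => ((hC n).continuous_fderiv one_ne_zero).aestronglyMeasurable
  have hG := memLp_innerSL hg
  have hφL : ∀ n, MemLp (φ n) 2 volume := fun n =>
    (hC n).continuous.memLp_of_hasCompactSupport (hc n)
  have hsmall : ∀ᶠ n in atTop, gnsConst *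
      eLpNorm (fun x => fderiv ℝ (φ n) x - innerSL ℝ (g x)) 2 volume ≤ 1 / 4 := by
    have := ENNReal.Tendsto.const_mul hD (Or.inr (ENNReal.coe_ne_top (r := gnsConst)))
    rw [mul_zero] at this
    exact ENNReal.tendsto_nhds_zero.1 this _ (by norm_num)
  obtain ⟨n₀, hn₀⟩ := eventually_atTop.1 hsmall
  have hE : Continuous fun s : ℝ => Real.exp s - 1 - s := by fun_prop
  have hu : MemLp (fun x => v x - φ n₀ x) 2 volume := hv.sub (hφL n₀)
  have hFatou := Lp.eLpNorm_lim_le_liminf_eLpNorm (p := 2) (μ := (volume : Measure Plane))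
    (f := fun n x => Real.exp (φ n x - φ n₀ x) - 1 - (φ n x - φ n₀ x))
    (fun n => hE.comp_aestronglyMeasurable ((hmφ n).sub (hmφ n₀)))
    (fun x => Real.exp (v x - φ n₀ x) - 1 - (v x - φ n₀ x))
    (hae.mono fun x hx => (hE.tendsto _).comp (hx.sub_const _))
  have hbound : ∀ n, n₀ ≤ n →
      eLpNorm (fun x => Real.exp (φ n x - φ n₀ x) - 1 - (φ n x - φ n₀ x)) 2 volume ≤
        eLpNorm (fun x => φ n x - v x) 2 volume + eLpNorm (fun x => φ n₀ x - v x) 2 volume := by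
    intro n hn
    have hdiff : fderiv ℝ (fun x => φ n x - φ n₀ x) =
        (fun x => fderiv ℝ (φ n) x - innerSL ℝ (g x)) -
          fun x => fderiv ℝ (φ n₀) x - innerSL ℝ (g x) := by
      funext x
      rw [fderiv_fun_sub ((hC n).differentiable one_ne_zero x)
        ((hC n₀).differentiable one_ne_zero x)]
      simp
    have hgrad : gnsConst * eLpNorm (fderiv ℝ fun x => φ n x - φ n₀ x) 2 volume ≤ 1 / 2 := by
      rw [hdiff]
      have hs := eLpNorm_sub_le (p := 2) ((hmD n).sub hG.1) ((hmD n₀).sub hG.1) (by norm_num)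
      calc _ ≤ _ := mul_le_mul_right hs _
        _ ≤ 1 / 4 + 1 / 4 := by
          rw [mul_add]
          exact add_le_add (hn₀ n hn) (hn₀ n₀ le_rfl)
        _ = 1 / 2 := by
          rw [ENNReal.div_add_div_same, ENNReal.div_eq_div_iff] <;> norm_num
    refine (eLpNorm_exp_sub_one_sub_le ((hC n).sub (hC n₀)) ((hc n).sub (hc n₀)) hgrad).trans ?_
    have hs := eLpNorm_sub_le (p := 2) ((hmφ n).sub hv.1) ((hmφ n₀).sub hv.1) (by norm_num)
    rwa [sub_sub_sub_cancel_right] at hs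
  have hEu : MemLp (fun x => Real.exp (v x - φ n₀ x) - 1 - (v x - φ n₀ x)) 2 volume := by
    refine ⟨hE.comp_aestronglyMeasurable hu.1, hFatou.trans_lt ?_⟩
    have hlim := hφ.add_const (eLpNorm (fun x => φ n₀ x - v x) 2 volume)
    refine (liminf_le_liminf ((eventually_ge_atTop n₀).mono hbound)).trans_lt ?_
    rw [hlim.liminf_eq, zero_add]
    exact ((hφL n₀).sub hv).eLpNorm_lt_top
  have hexp : MemLp (fun x => Real.exp (v x - φ n₀ x) - 1) 2 volume := by
    convert hEu.add hu using 1
    funext x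
    simp
  have hIu : Integrable (fun x => Real.exp (v x - φ n₀ x) - 1 - (v x - φ n₀ x)) volume := by
    refine (hu.integrable_mul hexp).mono hEu.1 (Eventually.of_forall fun x => ?_)
    rw [Real.norm_of_nonneg (exp_sub_one_sub_nonneg _)]
    exact (exp_sub_one_sub_le_mul _).trans (le_abs_self _)
  have hφcont := (hC n₀).continuous
  obtain ⟨B, hB⟩ := (hc n₀).exists_bound_of_continuous hφcont
  have h1 : Integrable (fun x => Real.exp (φ n₀ x) *
      (Real.exp (v x - φ n₀ x) - 1 - (v x - φ n₀ x))) volume := by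
    refine hIu.bdd_mul (c := Real.exp B) (by fun_prop) (Eventually.of_forall fun x => ?_)
    rw [Real.norm_of_nonneg (Real.exp_pos _).le]
    exact Real.exp_le_exp.2 ((le_abs_self _).trans (hB x))
  have h2 : Integrable (fun x => Real.exp (φ n₀ x) - 1 - φ n₀ x) volume :=
    (hE.comp hφcont).integrable_of_hasCompactSupport
      ((hc n₀).comp_left (g := fun s : ℝ => Real.exp s - 1 - s) (by simp))
  have h3 : Integrable (fun x => (Real.exp (φ n₀ x) - 1) * (v x - φ n₀ x)) volume := by
    have : MemLp (fun x => Real.exp (φ n₀ x) - 1) 2 volume :=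
      Continuous.memLp_of_hasCompactSupport (by fun_prop)
        ((hc n₀).comp_left (g := fun s : ℝ => Real.exp s - 1) (by simp))
    exact this.integrable_mul hu
  refine ((h1.add h2).add h3).congr (Eventually.of_forall fun x => ?_)
  have : Real.exp (v x) = Real.exp (φ n₀ x) * Real.exp (v x - φ n₀ x) := by
    rw [← Real.exp_add]
    simp
  simp only [Pi.add_apply, this]
  ring

/-! ### The weight `H₀` and pointwise bounds for the potential -/

theorem log_ratio_eq {μ r : ℝ} (hμ : 0 < μ) (hr : 0 < r) :
    Real.log (r ^ 2 / (μ + r ^ 2)) = -Real.log (1 + μ / r ^ 2) := by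
  rw [← Real.log_inv]
  congr 1
  field_simp
  ring

/-- In polar coordinates the logarithm is `O(r^{-1/2})` at the origin and `O(r^{-2})` at
infinity, so it is square integrable on the plane. -/
theorem integrable_log_ratio_sq {μ : ℝ} (hμ : 0 < μ) :
    Integrable (fun x : Plane => Real.log (‖x‖ ^ 2 / (μ + ‖x‖ ^ 2)) ^ 2) volume := by
  rw [integrable_fun_norm_addHaar volume (E := Plane)
    (f := fun r : ℝ => Real.log (r ^ 2 / (μ + r ^ 2)) ^ 2), finrank_euclideanSpace_fin]
  have hmeas : Measurable fun r : ℝ =>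
      r ^ (2 - 1) • Real.log (r ^ 2 / (μ + r ^ 2)) ^ 2 := by fun_prop
  rw [← Set.Ioc_union_Ioi_eq_Ioi (zero_le_one (α := ℝ))]
  refine IntegrableOn.union ?_ ?_
  · refine Measure.integrableOn_of_bounded (M := 16 * √(μ + 1)) (by simp)
      hmeas.aestronglyMeasurable ?_
    refine (ae_restrict_iff' measurableSet_Ioc).2 (Eventually.of_forall fun r hr => ?_)
    have hr0 : 0 < r := hr.1
    have hz : 1 ≤ 1 + μ / r ^ 2 := by
      have : 0 ≤ μ / r ^ 2 := by positivity
      linarith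
    rw [log_ratio_eq hμ hr0]
    set z := 1 + μ / r ^ 2 with hzdef
    have hlog0 : 0 ≤ Real.log z := Real.log_nonneg hz
    have hlog : Real.log z ≤ 4 * √√z := by
      have h1 : Real.log √√z ≤ √√z := Real.log_le_self (Real.sqrt_nonneg _)
      rw [Real.log_sqrt (Real.sqrt_nonneg _), Real.log_sqrt (by linarith)] at h1
      linarith
    have hsq : Real.log z ^ 2 ≤ 16 * √z := by
      calc Real.log z ^ 2 ≤ (4 * √√z) ^ 2 := by gcongr
        _ = 16 * √z := by rw [mul_pow, Real.sq_sqrt (Real.sqrt_nonneg _)]; norm_num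
    have hrz : r * √z ≤ √(μ + 1) := by
      have h1 : r * √z = √(r ^ 2 * z) := by
        rw [Real.sqrt_mul (sq_nonneg r), Real.sqrt_sq hr0.le]
      rw [h1]
      refine Real.sqrt_le_sqrt ?_
      have h2 : r ^ 2 * z = r ^ 2 + μ := by rw [hzdef]; field_simp
      have h3 : r ^ 2 ≤ 1 := pow_le_one₀ hr0.le hr.2
      linarith
    rw [neg_sq, smul_eq_mul, Real.norm_of_nonneg (by positivity)]
    calc r ^ (2 - 1) * Real.log z ^ 2 ≤ r * (16 * √z) := by
          rw [show 2 - 1 = 1 from rfl, pow_one]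
          gcongr
      _ = 16 * (r * √z) := by ring
      _ ≤ _ := by gcongr
  · have hdec : IntegrableOn (fun r : ℝ => μ ^ 2 * r ^ (-3 : ℝ)) (Set.Ioi 1) :=
      (integrableOn_Ioi_rpow_of_lt (by norm_num) one_pos).const_mul _
    refine Integrable.mono' hdec hmeas.aestronglyMeasurable ?_
    refine (ae_restrict_iff' measurableSet_Ioi).2 (Eventually.of_forall fun r hr => ?_)
    have hr0 : 0 < r := one_pos.trans hr
    have hy : 0 ≤ μ / r ^ 2 := by positivity
    rw [log_ratio_eq hμ hr0, neg_sq, smul_eq_mul, Real.norm_of_nonneg (by positivity)]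
    have hlog0 : 0 ≤ Real.log (1 + μ / r ^ 2) := Real.log_nonneg (by linarith)
    have hlog : Real.log (1 + μ / r ^ 2) ≤ μ / r ^ 2 := by
      have := Real.log_le_sub_one_of_pos (show 0 < 1 + μ / r ^ 2 by linarith)
      linarith
    calc r ^ (2 - 1) * Real.log (1 + μ / r ^ 2) ^ 2 ≤ r * (μ / r ^ 2) ^ 2 := by
          rw [show 2 - 1 = 1 from rfl, pow_one]
          gcongr
      _ = μ ^ 2 * r ^ (-3 : ℝ) := by
          rw [show (-3 : ℝ) = ((-3 : ℤ) : ℝ) by norm_num, Real.rpow_intCast]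
          rw [show (-3 : ℤ) = -((3 : ℕ) : ℤ) by norm_num, zpow_neg, zpow_natCast]
          field_simp

theorem memLp_u0 {N : ℕ} (p : Fin N → Plane) {μ : ℝ} (hμ : 0 < μ) :
    MemLp (u0 p μ) 2 volume := by
  unfold u0
  refine memLp_finsetSum _ fun s _ => ?_
  rw [memLp_two_iff_integrable_sq (Measurable.aestronglyMeasurable (by fun_prop))]
  exact (integrable_log_ratio_sq hμ).comp_sub_right (p s)

theorem H0_nonneg {N : ℕ} (p : Fin N → Plane) (μ : ℝ) (x : Plane) : 0 ≤ H0 p μ x := by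
  unfold H0
  split_ifs
  · exact le_rfl
  · exact (Real.exp_pos _).le

theorem H0_le_one {N : ℕ} (p : Fin N → Plane) {μ : ℝ} (hμ : 0 < μ) (x : Plane) :
    H0 p μ x ≤ 1 := by
  rw [H0_eq_prod p hμ]
  refine Finset.prod_le_one (fun s _ => by positivity) fun s _ => ?_
  refine div_le_one_of_le₀ (by linarith) (by positivity)

theorem measurable_H0 {N : ℕ} (p : Fin N → Plane) {μ : ℝ} (hμ : 0 < μ) :
    Measurable (H0 p μ) := by
  rw [show H0 p μ = _ from funext (H0_eq_prod p hμ)]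
  fun_prop

theorem ae_H0_eq_exp {N : ℕ} (p : Fin N → Plane) (μ : ℝ) :
    ∀ᵐ x, H0 p μ x = Real.exp (u0 p μ x) := by
  filter_upwards [(Set.finite_range p).countable.ae_notMem volume] with x hx
  rw [H0, if_neg]
  rintro ⟨s, rfl⟩
  exact hx ⟨s, rfl⟩

theorem inv_pow_le_H0 {N : ℕ} (p : Fin N → Plane) {μ : ℝ} (hμ : 1 < μ) {x : Plane}
    (hx : x ∉ ⋃ s, Metric.ball (p s) 1) : ((2 * μ) ^ N)⁻¹ ≤ H0 p μ x := by
  rw [H0_eq_prod p (one_pos.trans hμ)]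
  have hc : ((2 * μ) ^ N)⁻¹ = ∏ _s : Fin N, (2 * μ)⁻¹ := by
    rw [Finset.prod_const, Finset.card_univ, Fintype.card_fin, inv_pow]
  rw [hc]
  refine Finset.prod_le_prod (fun s _ => by positivity) fun s _ => ?_
  have hs : 1 ≤ ‖x - p s‖ := by
    simp only [Set.mem_iUnion, not_exists, Metric.mem_ball, not_lt, dist_eq_norm] at hx
    exact hx s
  have hs2 : 1 ≤ ‖x - p s‖ ^ 2 := one_le_pow₀ hs
  rw [inv_eq_one_div, div_le_div_iff₀ (by positivity) (by positivity)]
  nlinarith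

theorem exp_sub_one_sub_ge_of_nonneg {w : ℝ} (hw : 0 ≤ w) :
    w ^ 2 / (1 + w) / 4 ≤ Real.exp (-w) - 1 + w := by
  rw [div_div, div_le_iff₀ (by positivity)]
  rcases le_total w 2 with h | h
  · have h1 : (1 - w / 2) ^ 2 ≤ Real.exp (-w) := by
      have h2 : 1 - w / 2 ≤ Real.exp (-(w / 2)) := by linarith [Real.add_one_le_exp (-(w / 2))]
      have h3 : Real.exp (-w) = Real.exp (-(w / 2)) ^ 2 := by
        rw [← Real.exp_nat_mul]
        congr 1
        push_cast
        ring
      rw [h3]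
      exact pow_le_pow_left₀ (by linarith) h2 2
    nlinarith [mul_nonneg hw (sq_nonneg w)]
  · have h1 := Real.exp_pos (-w)
    nlinarith

theorem potential_pointwise_of_le {c L v : ℝ} (hc : 0 < c) (hcL : c ≤ Real.exp (-L))
    (hv : 0 ≤ v) :
    c / 4 * v ^ 2 - L ^ 2 / c ≤
      Real.exp (-L) * (Real.exp v - 1 - v) + (Real.exp (-L) - 1) * v := by
  have h1 := Real.quadratic_le_exp_of_nonneg hv
  have h2 := Real.add_one_le_exp (-L)
  have h3 : c * (v ^ 2 / 2) ≤ Real.exp (-L) * (Real.exp v - 1 - v) := by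
    gcongr
    linarith
  have h4 : L * v ≤ c / 4 * v ^ 2 + L ^ 2 / c := by
    have : c / 4 * v ^ 2 + L ^ 2 / c - L * v = (c * v / 2 - L) ^ 2 / c := by
      field_simp
      ring
    have h5 : 0 ≤ (c * v / 2 - L) ^ 2 / c := by positivity
    linarith
  nlinarith [mul_le_mul_of_nonneg_right h2 hv]

/-- Where the weight `e^{-L}` degenerates, the exponential growth in `v` still dominates `v²` at the
price of a multiple of `L²`. -/
theorem potential_pointwise_degenerate {c L v : ℝ} (hc : c ≤ 1) (hL : 0 ≤ L) (hv : 0 ≤ v) :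
    c / 4 * v ^ 2 - L ^ 2 - 2 ≤
      Real.exp (-L) * (Real.exp v - 1 - v) + (Real.exp (-L) - 1) * v := by
  have h1 : Real.exp (-L) * Real.exp v = Real.exp (v - L) := by
    rw [← Real.exp_add]
    ring_nf
  have h2 : Real.exp (-L) ≤ 1 := Real.exp_le_one_iff.2 (by linarith)
  have h3 : c / 4 * v ^ 2 ≤ 1 / 4 * v ^ 2 := by gcongr
  have h4 : 1 / 4 * v ^ 2 - L ^ 2 - 2 ≤ Real.exp (v - L) - 1 - v := by
    -- for `v ≥ L` the quadratic part of `e^{v - L}` suffices, for `v ≤ L` the term `L²` does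
    rcases le_total L v with h | h
    · have h5 := Real.quadratic_le_exp_of_nonneg (sub_nonneg.2 h)
      nlinarith [sq_nonneg (v - 2 * L), sq_nonneg (L - 1)]
    · have h5 := Real.exp_pos (v - L)
      nlinarith [sq_nonneg (3 * L - 2)]
  linarith

/-- The integrable function controlling the potential from below: it collects what the linear term
`(H₀ - 1) v` and the vanishing of `H₀` at the vortex points can cost. -/
def potentialLoss {N : ℕ} (p : Fin N → Plane) (μ : ℝ) (x : Plane) : ℝ :=
  ((2 * μ) ^ N + 1) * u0 p μ x ^ 2 + (⋃ s, Metric.ball (p s) 1).indicator (fun _ => 2) x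

theorem potentialLoss_nonneg {N : ℕ} (p : Fin N → Plane) {μ : ℝ} (hμ : 0 < μ) (x : Plane) :
    0 ≤ potentialLoss p μ x :=
  add_nonneg (by positivity) (Set.indicator_nonneg (fun _ _ => by norm_num) x)

theorem integrable_potentialLoss {N : ℕ} (p : Fin N → Plane) {μ : ℝ} (hμ : 0 < μ) :
    Integrable (potentialLoss p μ) volume := by
  refine ((memLp_u0 p hμ).integrable_sq.const_mul _).add ?_
  refine (integrable_indicator_iff (MeasurableSet.iUnion fun s => measurableSet_ball)).2 ?_
  refine integrableOn_const ?_
  exact ((measure_iUnion_le _).trans_lt (by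
    rw [tsum_fintype]
    exact ENNReal.sum_lt_top.2 fun s _ => measure_ball_lt_top)).ne

theorem ae_potential_ge {N : ℕ} (p : Fin N → Plane) {μ : ℝ} (hμ : 1 < μ) (v : Plane → ℝ) :
    ∀ᵐ x, ((2 * μ) ^ N)⁻¹ / 4 * max (v x) 0 ^ 2 +
      max (-v x) 0 ^ 2 / (1 + max (-v x) 0) / 4 - potentialLoss p μ x ≤ potential p μ v x := by
  have hμ0 : 0 < μ := one_pos.trans hμ
  filter_upwards [ae_H0_eq_exp p μ] with x hx
  have hH1 := H0_le_one p hμ0 x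
  have hball : ((2 * μ) ^ N)⁻¹ ≤ H0 p μ x ∨ x ∈ ⋃ s, Metric.ball (p s) 1 := by
    by_cases h : x ∈ ⋃ s, Metric.ball (p s) 1
    · exact Or.inr h
    · exact Or.inl (inv_pow_le_H0 p hμ h)
  have hG := potentialLoss_nonneg p hμ0 x
  rcases le_total 0 (v x) with hv | hv
  · rw [max_eq_left hv, max_eq_right (by linarith : -v x ≤ 0)]
    have hc0 : 0 < ((2 * μ) ^ N)⁻¹ := by positivity
    have hc1 : ((2 * μ) ^ N)⁻¹ ≤ 1 := inv_le_one_of_one_le₀ (one_le_pow₀ (by linarith))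
    have hL0 : 0 ≤ -u0 p μ x := by
      rw [hx, Real.exp_le_one_iff] at hH1
      linarith
    have hHL : H0 p μ x = Real.exp (-(-u0 p μ x)) := by rw [hx, neg_neg]
    unfold potential
    rw [hHL] at hball ⊢
    have hsq : 0 ≤ u0 p μ x ^ 2 := sq_nonneg _
    have hpow : 0 ≤ (2 * μ) ^ N := by positivity
    rcases hball with h | h
    · have h1 := potential_pointwise_of_le hc0 h hv
      have h2 : (2 * μ) ^ N * u0 p μ x ^ 2 ≤ potentialLoss p μ x := by
        have : 0 ≤ (⋃ s, Metric.ball (p s) 1).indicator (fun _ => (2 : ℝ)) x :=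
          Set.indicator_nonneg (fun _ _ => by norm_num) x
        unfold potentialLoss
        nlinarith
      rw [div_inv_eq_mul, neg_sq, mul_comm (u0 p μ x ^ 2)] at h1
      refine le_trans ?_ h1
      norm_num
      linarith
    · have h1 := potential_pointwise_degenerate hc1 hL0 hv
      have h2 : u0 p μ x ^ 2 + 2 ≤ potentialLoss p μ x := by
        unfold potentialLoss
        rw [Set.indicator_of_mem h]
        nlinarith
      rw [neg_sq] at h1
      refine le_trans ?_ h1
      norm_num
      linarith
  · rw [max_eq_right hv, max_eq_left (by linarith : 0 ≤ -v x)]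
    have h1 := exp_sub_one_sub_ge_of_nonneg (neg_nonneg.2 hv)
    rw [neg_neg] at h1
    have h2 : Real.exp (v x) ≤ 1 := Real.exp_le_one_iff.2 hv
    unfold potential
    nlinarith

/-! ### Integrated bounds and coercivity -/

theorem l2norm_nonneg {F : Type*} [NormedAddCommGroup F] (f : Plane → F) : 0 ≤ l2norm f :=
  ENNReal.toReal_nonneg

theorem l2norm_sq {f : Plane → ℝ} (hf : MemLp f 2 volume) : l2norm f ^ 2 = ∫ x, f x ^ 2 := by
  rw [l2norm, ← ENNReal.toReal_pow, eLpNorm_two_sq,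
    integral_eq_lintegral_of_nonneg_ae (Eventually.of_forall fun x => sq_nonneg _)
      (hf.1.pow 2)]
  congr 1
  refine lintegral_congr fun x => ?_
  rw [← sq_abs (f x), ENNReal.ofReal_pow (abs_nonneg _), Real.enorm_eq_ofReal_abs]

theorem MemW12.integrable_potential {N : ℕ} (p : Fin N → Plane) {μ : ℝ} (hμ : 0 < μ)
    {v : Plane → ℝ} (hv : MemW12 v) : Integrable (potential p μ v) volume := by
  have hE := hv.weakGrad_spec.2.integrable_exp_sub_one_sub hv.1 hv.weakGrad_spec.1
  have h1 : Integrable (fun x => H0 p μ x * (Real.exp (v x) - 1 - v x)) volume := by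
    refine hE.bdd_mul (c := 1) (measurable_H0 p hμ).aestronglyMeasurable
      (Eventually.of_forall fun x => ?_)
    rw [Real.norm_of_nonneg (H0_nonneg p μ x)]
    exact H0_le_one p hμ x
  have h2 : MemLp (fun x => H0 p μ x - 1) 2 volume := by
    refine (memLp_u0 p hμ).of_le
      ((measurable_H0 p hμ).sub_const 1).aestronglyMeasurable ?_
    filter_upwards [ae_H0_eq_exp p μ] with x hx
    have hH1 := H0_le_one p hμ x
    rw [Real.norm_eq_abs, Real.norm_eq_abs, abs_of_nonpos (by linarith)]
    have := Real.add_one_le_exp (u0 p μ x)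
    refine le_trans ?_ (neg_le_abs _)
    linarith
  exact h1.add (h2.integrable_mul hv.1)

/-- Interpolation against a fourth power bound: `‖w⁴‖₁ ≤ B² ‖w‖₂²` makes the large values of `w`
harmless, so that `∫ w² / (1 + w)` controls `‖w‖₂²`. -/
theorem l2norm_sq_le_of_l2norm_sq_le {w : Plane → ℝ} (hw : MemLp w 2 volume)
    (hw2 : MemLp (fun x => w x ^ 2) 2 volume) (hw0 : ∀ x, 0 ≤ w x) {B : ℝ} (hB : 0 ≤ B)
    (h : l2norm (fun x => w x ^ 2) ≤ B * l2norm w) :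
    Integrable (fun x => w x ^ 2 / (1 + w x)) volume ∧
      l2norm w ^ 2 ≤ (2 + B) * ∫ x, w x ^ 2 / (1 + w x) := by
  have hi2 : Integrable (fun x => w x ^ 2) volume := hw.integrable_sq
  have hi4 : Integrable (fun x => (w x ^ 2) ^ 2) volume := hw2.integrable_sq
  have hA : Integrable (fun x => w x ^ 2 / (1 + w x)) volume := by
    refine hi2.mono (((hw.1.aemeasurable.pow_const 2).div
      (hw.1.aemeasurable.const_add 1)).aestronglyMeasurable) (Eventually.of_forall fun x => ?_)
    have h0 := hw0 x
    rw [Real.norm_of_nonneg (by positivity), Real.norm_of_nonneg (by positivity)]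
    exact div_le_self (sq_nonneg _) (by linarith)
  refine ⟨hA, ?_⟩
  have h4 : ∫ x, (w x ^ 2) ^ 2 ≤ B ^ 2 * ∫ x, w x ^ 2 := by
    rw [← l2norm_sq hw2, ← l2norm_sq hw, ← mul_pow]
    exact pow_le_pow_left₀ (l2norm_nonneg _) h 2
  -- `θ` balances `w³ ≤ θ w² / 2 + w⁴ / (2 θ)`, and the extra `1` keeps it positive when `B = 0`
  set θ := B + 1 with hθ
  have hθ0 : 0 < θ := by positivity
  have hpt : ∀ x, w x ^ 2 ≤ (1 + θ) / 2 * (w x ^ 2 / (1 + w x)) +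
      ((1 + θ / 2) / (2 * (1 + θ)) * w x ^ 2 + 1 / (4 * θ * (1 + θ)) * (w x ^ 2) ^ 2) := by
    intro x
    have h0 := hw0 x
    generalize w x = t at h0
    have h1 : 0 < 1 + t := by positivity
    have e1 : t ^ 2 ≤ (1 + θ) / 2 * (t ^ 2 / (1 + t)) + t ^ 2 * (1 + t) / (2 * (1 + θ)) := by
      have : (1 + θ) / 2 * (t ^ 2 / (1 + t)) + t ^ 2 * (1 + t) / (2 * (1 + θ)) - t ^ 2 =
          t ^ 2 * ((1 + θ) - (1 + t)) ^ 2 / (2 * (1 + t) * (1 + θ)) := by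
        field_simp
        ring
      have h2 : 0 ≤ t ^ 2 * ((1 + θ) - (1 + t)) ^ 2 / (2 * (1 + t) * (1 + θ)) := by positivity
      linarith
    have e2 : t ^ 2 * (1 + t) / (2 * (1 + θ)) ≤
        (1 + θ / 2) / (2 * (1 + θ)) * t ^ 2 + 1 / (4 * θ * (1 + θ)) * (t ^ 2) ^ 2 := by
      have : (1 + θ / 2) / (2 * (1 + θ)) * t ^ 2 + 1 / (4 * θ * (1 + θ)) * (t ^ 2) ^ 2 -
          t ^ 2 * (1 + t) / (2 * (1 + θ)) = t ^ 2 * (t - θ) ^ 2 / (4 * θ * (1 + θ)) := by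
        field_simp
        ring
      have h2 : 0 ≤ t ^ 2 * (t - θ) ^ 2 / (4 * θ * (1 + θ)) := by positivity
      linarith
    linarith
  have hint := integral_mono hi2 ((hA.const_mul ((1 + θ) / 2)).add
    ((hi2.const_mul ((1 + θ / 2) / (2 * (1 + θ)))).add
      (hi4.const_mul (1 / (4 * θ * (1 + θ)))))) hpt
  rw [integral_add' (hA.const_mul _) ((hi2.const_mul _).add (hi4.const_mul _)),
    integral_add' (hi2.const_mul _) (hi4.const_mul _), integral_const_mul, integral_const_mul,
    integral_const_mul] at hint
  rw [l2norm_sq hw]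
  have hS0 : 0 ≤ ∫ x, w x ^ 2 := integral_nonneg fun x => sq_nonneg _
  generalize (∫ x, w x ^ 2) = S at *
  generalize (∫ x, (w x ^ 2) ^ 2) = Q at *
  generalize (∫ x, w x ^ 2 / (1 + w x)) = A at *
  have hQ : Q ≤ θ ^ 2 * S := by
    refine h4.trans ?_
    gcongr
    linarith
  have h5 : 1 / (4 * θ * (1 + θ)) * Q ≤ θ / (4 * (1 + θ)) * S := by
    calc _ ≤ 1 / (4 * θ * (1 + θ)) * (θ ^ 2 * S) := by gcongr
      _ = _ := by field_simp
  have h6 : (1 + θ / 2) / (2 * (1 + θ)) * S + θ / (4 * (1 + θ)) * S = S / 2 := by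
    field_simp
    ring
  have h7 : 2 + B = 1 + θ := by rw [hθ]; ring
  rw [h7]
  linarith

/-- The `L²` norm of the negative part is controlled by the weaker integral that the potential
provides, up to a factor growing linearly in the gradient. -/
theorem MemW12.l2norm_negPart_sq_le {v : Plane → ℝ} (hv : MemW12 v) :
    Integrable (fun x => max (-v x) 0 ^ 2 / (1 + max (-v x) 0)) volume ∧
    l2norm (fun x => max (-v x) 0) ^ 2 ≤ (2 + 2 * gnsConst * l2norm (weakGrad v)) *
      ∫ x, max (-v x) 0 ^ 2 / (1 + max (-v x) 0) := by
  obtain ⟨hg, hwg⟩ := hv.weakGrad_spec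
  have hL := hwg.eLpNorm_negPart_sq_le hv.1 hg
  have hw : MemLp (fun x => max (-v x) 0) 2 volume := hv.1.neg.pos_part
  have hfin : 2 * (gnsConst : ℝ≥0∞) *
      (eLpNorm (fun x => max (-v x) 0) 2 volume * eLpNorm (weakGrad v) 2 volume) ≠ ⊤ :=
    ENNReal.mul_ne_top (ENNReal.mul_ne_top (by norm_num) ENNReal.coe_ne_top)
      (ENNReal.mul_ne_top hw.eLpNorm_ne_top hg.eLpNorm_ne_top)
  have hLreal : l2norm (fun x => max (-v x) 0 ^ 2) ≤
      2 * gnsConst * (l2norm (fun x => max (-v x) 0) * l2norm (weakGrad v)) := by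
    have := ENNReal.toReal_mono hfin hL
    simpa [l2norm] using this
  refine l2norm_sq_le_of_l2norm_sq_le hw ⟨hw.1.pow 2, hL.trans_lt hfin.lt_top⟩
    (fun x => le_max_right _ _) ?_ ?_
  · have := l2norm_nonneg (weakGrad v)
    positivity
  · exact hLreal.trans_eq (by ring)

end PlanarVortex

end

open PlanarVortex in
theorem lemma5p1 {N : ℕ} (p : Fin N → PlanarVortex.Plane) :
    ∃ b₀ : ℝ, 0 < b₀ ∧
      ∀ α : ℝ, 0 < α → ∃ μα : ℝ, 1 < μα ∧
        ∀ μ : ℝ, μα < μ → ∃ C : ℝ, 0 < C ∧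
          ∀ v : PlanarVortex.Plane → ℝ, PlanarVortex.MemW12 v →
            Integrable (PlanarVortex.potential p μ v) volume ∧
            PlanarVortex.J p α μ v ≥
              1 / 4 * PlanarVortex.l2norm (PlanarVortex.weakGrad v) ^ 2
                + α / 2 * PlanarVortex.l2norm (fun x => max (-(v x)) 0)
                + α ^ 2 * b₀ / μ ^ N * PlanarVortex.l2norm (fun x => max (v x) 0) ^ 2
                - C := by
  refine ⟨(2 ^ N)⁻¹ / 4, by positivity, fun α hα => ⟨2, one_lt_two, fun μ hμ => ?_⟩⟩
  have hμ1 : 1 < μ := one_lt_two.trans hμ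
  have hμ0 : 0 < μ := one_pos.trans hμ1
  set I := ∫ x, potentialLoss p μ x
  have hI0 : 0 ≤ I := integral_nonneg fun x => potentialLoss_nonneg p hμ0 x
  set K : ℝ := 2 * gnsConst
  refine ⟨α ^ 2 * I + 1 / 2 + K ^ 2 / 16, by positivity, fun v hv => ?_⟩
  have hpot := hv.integrable_potential p hμ0
  refine ⟨hpot, ?_⟩
  obtain ⟨hA, hWA⟩ := hv.l2norm_negPart_sq_le
  have hP : MemLp (fun x => max (v x) 0) 2 volume := hv.1.pos_part
  have hloss := integrable_potentialLoss p hμ0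
  have h1 := integral_mono_ae (((hP.integrable_sq.const_mul (((2 * μ) ^ N)⁻¹ / 4)).add
    (hA.div_const 4)).sub hloss) hpot (ae_potential_ge p hμ1 v)
  rw [integral_sub' ((hP.integrable_sq.const_mul _).add (hA.div_const 4)) hloss,
    integral_add' (hP.integrable_sq.const_mul _) (hA.div_const 4), integral_const_mul,
    integral_div, ← l2norm_sq hP] at h1
  have hc : α ^ 2 * ((2 ^ N)⁻¹ / 4) / μ ^ N = α ^ 2 * (((2 * μ) ^ N)⁻¹ / 4) := by
    rw [mul_pow, mul_inv]
    ring
  rw [hc, J]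
  have hD0 := l2norm_nonneg (weakGrad v)
  generalize l2norm (weakGrad v) = D at *
  generalize l2norm (fun x => max (-(v x)) 0) = W at *
  generalize (∫ x, max (-v x) 0 ^ 2 / (1 + max (-v x) 0)) = A at *
  generalize (∫ x, potential p μ v x) = S at *
  have hT : 0 < 2 + K * D := by positivity
  -- the linear term in `W` is absorbed by `α² A / 4`, up to a term linear in `D`
  have h2 : α / 2 * W ≤ α ^ 2 * A / 4 + (2 + K * D) / 4 := by
    have h3 : α ^ 2 * W ^ 2 / (4 * (2 + K * D)) ≤ α ^ 2 * A / 4 := by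
      rw [div_le_div_iff₀ (by positivity) (by norm_num)]
      nlinarith [mul_le_mul_of_nonneg_left hWA (sq_nonneg α)]
    have h4 : α ^ 2 * W ^ 2 / (4 * (2 + K * D)) + (2 + K * D) / 4 - α / 2 * W =
        (α * W - (2 + K * D)) ^ 2 / (4 * (2 + K * D)) := by
      field_simp
      ring
    have h5 : 0 ≤ (α * W - (2 + K * D)) ^ 2 / (4 * (2 + K * D)) := by positivity
    linarith
  have h6 := mul_le_mul_of_nonneg_left h1 (sq_nonneg α)
  -- the square says that `K D / 4 ≤ D² / 4 + K² / 16`, using up the spare Dirichlet energy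
  nlinarith [sq_nonneg (D / 2 - K / 4)]
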